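/- Let $n\ge 2$ and write $\mathbb R^n_+=\{x\in\mathbb R^n: x_n>0\}$. For an open set $U$, $C_0^\infty(U)$ denotes the real-valued smooth functions with compact support contained in $U$. For a function $u$ of $(x,t)\in\mathbb R^n\times\mathbb R$, $\nabla u=(\nabla_x u,\partial_t u)$ is the full gradient, so that $|\nabla u|^2=|\nabla_x u|^2+(\partial_t u)^2$. (i) For every $u\in C_0^\infty(\mathbb R^n_+\times\mathbb R)$, $$\int_{\mathbb R}\int_{\mathbb R^n_+}|\nabla u(x,t)|^2\,dx\,dt\ \ge\ \frac14\int_{\mathbb R}\int_{\mathbb R^n_+}\frac{u(x,t)^2}{x_n^2}\,dx\,dt+4\left(\frac{\Gamma(3/4)}{\Gamma(1/4)}\right)^2\int_{\mathbb R^n_+}\frac{u(x,0)^2}{x_n}\,dx .$$ (ii) Let $\Omega\subsetneq\mathbb R^n$ be a proper domain (a nonempty connected open set different from $\mathbb R^n$), let $d(x)=\inf\{|x-y|: y\in\partial\Omega\}$, and assume that $-\Delta d\ge 0$ in $\Omega$ in the sense of distributions, i.e. $\int_\Omega d\,(-\Delta\varphi)\,dx\ge 0$ for every nonnegative $\varphi\in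 C_0^\infty(\Omega)$. Then for every $u\in C_0^\infty(\Omega\times\mathbb R)$, $$\int_{\mathbb R}\int_{\Omega}|\nabla u(x,t)|^2\,dx\,dt\ \ge\ \frac14\int_{\mathbb R}\int_{\Omega}\frac{u(x,t)^2}{d(x)^2}\,dx\,dt+4\left(\frac{\Gamma(3/4)}{\Gamma(1/4)}\right)^2\int_{\Omega}\frac{u(x,0)^2}{d(x)}\,dx .$$ -/

import Mathlib

open MeasureTheory
open scoped ContDiff Laplacian Gradient

noncomputable section

namespace TraceHardy

/-- Membership in `C₀^∞(U)`: infinitely differentiable functions whose (closed) support is a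
compact subset of `U`. Such a function on `U` is identified with its extension by zero. -/
def IsTestFunction {F : Type*} [NormedAddCommGroup F] [NormedSpace ℝ F]
    (U : Set F) (φ : F → ℝ) : Prop :=
  ContDiff ℝ ∞ φ ∧ HasCompactSupport φ ∧ tsupport φ ⊆ U

/-- The index of the last coordinate `x_n` of a point of `ℝⁿ`, `n ≥ 2`. -/
def lastIdx (n : ℕ) (hn : 2 ≤ n) : Fin n :=
  ⟨n - 1, by omega⟩

/-- The half space `ℝⁿ₊ = {x ∈ ℝⁿ : x_n > 0}`. -/
def halfSpace (n : ℕ) (hn : 2 ≤ n) : Set (EuclideanSpace ℝ (Fin n)) :=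
  {x | 0 < x (lastIdx n hn)}

/-- The distance `d(x) = inf {|x - y| : y ∈ ∂Ω}` to the boundary. -/
def bdryDist {n : ℕ} (Ω : Set (EuclideanSpace ℝ (Fin n))) (x : EuclideanSpace ℝ (Fin n)) : ℝ :=
  Metric.infDist x (frontier Ω)

/-- `-Δ d ≥ 0` in `Ω` in the sense of distributions: `∫_Ω d (-Δ φ) dx ≥ 0` for every nonnegative
test function `φ ∈ C₀^∞(Ω)`. -/
def NegLaplacianDistNonneg {n : ℕ} (Ω : Set (EuclideanSpace ℝ (Fin n))) : Prop :=
  ∀ φ : EuclideanSpace ℝ (Fin n) → ℝ, IsTestFunction Ω φ → (∀ x, 0 ≤ φ x) →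
    0 ≤ ∫ x in Ω, bdryDist Ω x * (-(Δ φ) x)

/-- The squared Euclidean length `|∇u(x,t)|² = |∇ₓ u(x,t)|² + (∂ₜ u(x,t))²` of the full gradient
of a function `u` on `ℝⁿ × ℝ`. -/
def gradSq {n : ℕ} (u : EuclideanSpace ℝ (Fin n) × ℝ → ℝ)
    (x : EuclideanSpace ℝ (Fin n)) (t : ℝ) : ℝ :=
  ‖∇ (fun y => u (y, t)) x‖ ^ 2 + (deriv (fun τ => u (x, τ)) t) ^ 2

end TraceHardy

end

/-! The argument is a ground-state substitution with `W(x,t) = f(|t|/d(x))`, where `f = prof` is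
positive and solves `((1+z²)f')' + f/4 = 0`. When `|∇d| = 1` and `-Δd ≥ 0`, this `W` formally
satisfies `-ΔW ≥ W/(4d²)` off `t = 0`, and the kink of `|t|` at `t = 0` produces the trace term.

Only the logarithmic derivative `g = ric = -f'/f` is needed. It satisfies a Riccati equation which
says that `1/4 = potX + potT`, the shares of the potential controlled by `|∇ₓu|²` and by `(∂ₜu)²`.
Each share is obtained by completing a square and integrating by parts: `line_inequality` in `t` for
fixed `x`, and `slice_inequality` in `x` for fixed `t`. Fubini adds them up in `trace_hardy`. The
boundary term at `t = 0` is `2 g(0)/d`, and Beta integrals for `f(0)` and `f'(0)` give `g(0) =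
2(Γ(3/4)/Γ(1/4))²`.

The slice inequality tests superharmonicity against a function that is merely Lipschitz, since it
involves `d`; `integral_inner_gradient_nonneg` extends the distributional hypothesis to such
functions by mollification. Both settings enter through `SuperharmonicEikonal`, with `d = x_n` or
`d` the distance to the boundary. -/

noncomputable section

namespace TraceHardy

/-! ### An integral representation of a Legendre-type function -/

/-- The profile `(1 + x²)^{-1/2}`. -/
def kern (x : ℝ) : ℝ := (1 + x ^ 2) ^ (-(1 / 2) : ℝ)

/-- The derivative of `kern`. -/
def kern₁ (x : ℝ) : ℝ := -x * (1 + x ^ 2) ^ (-(3 / 2) : ℝ)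

/-- The second derivative of `kern`. -/
def kern₂ (x : ℝ) : ℝ :=
  -(1 + x ^ 2) ^ (-(3 / 2) : ℝ) + 3 * x ^ 2 * (1 + x ^ 2) ^ (-(5 / 2) : ℝ)

lemma one_add_sq_pos (x : ℝ) : 0 < 1 + x ^ 2 := by positivity

lemma kern_pos (x : ℝ) : 0 < kern x := Real.rpow_pos_of_pos (one_add_sq_pos x) _

lemma hasDerivAt_one_add_sq_rpow (x a : ℝ) :
    HasDerivAt (fun y : ℝ => (1 + y ^ 2) ^ a) (2 * x * a * (1 + x ^ 2) ^ (a - 1)) x := by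
  have h : HasDerivAt (fun y : ℝ => 1 + y ^ 2) (2 * x) x := by
    simpa using (hasDerivAt_pow 2 x).const_add 1
  exact h.rpow_const (Or.inl (one_add_sq_pos x).ne')

lemma hasDerivAt_kern (x : ℝ) : HasDerivAt kern (kern₁ x) x := by
  convert! hasDerivAt_one_add_sq_rpow x (-(1 / 2)) using 1
  rw [kern₁]; norm_num; left; ring

lemma hasDerivAt_kern₁ (x : ℝ) : HasDerivAt kern₁ (kern₂ x) x := by
  convert! (hasDerivAt_id x).neg.mul (hasDerivAt_one_add_sq_rpow x (-(3 / 2))) using 1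
  rw [kern₂]; norm_num; ring

lemma continuous_one_add_sq_rpow (a : ℝ) : Continuous fun y : ℝ => (1 + y ^ 2) ^ a :=
  continuous_iff_continuousAt.2 fun x => (hasDerivAt_one_add_sq_rpow x a).continuousAt

lemma continuous_kern : Continuous kern := continuous_one_add_sq_rpow _

lemma continuous_kern₁ : Continuous kern₁ := continuous_neg.mul (continuous_one_add_sq_rpow _)

lemma continuous_kern₂ : Continuous kern₂ := by
  have := continuous_one_add_sq_rpow (-(3 / 2))
  have := continuous_one_add_sq_rpow (-(5 / 2))
  unfold kern₂; fun_prop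

lemma rpow_neg_three_half_mul (x : ℝ) : (1 + x ^ 2) ^ (-(3 / 2) : ℝ) * (1 + x ^ 2) = kern x := by
  rw [kern, ← Real.rpow_add_one (one_add_sq_pos x).ne']; norm_num

lemma rpow_neg_five_half_mul (x : ℝ) :
    (1 + x ^ 2) ^ (-(5 / 2) : ℝ) * (1 + x ^ 2) = (1 + x ^ 2) ^ (-(3 / 2) : ℝ) := by
  rw [← Real.rpow_add_one (one_add_sq_pos x).ne']; norm_num

lemma one_add_sq_mul_kern₁ (x : ℝ) : (1 + x ^ 2) * kern₁ x = -x * kern x := by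
  rw [← rpow_neg_three_half_mul, kern₁]; ring

lemma one_add_sq_mul_kern₂ (x : ℝ) :
    (1 + x ^ 2) * kern₂ x = -3 * x * kern₁ x - kern x := by
  have h := rpow_neg_five_half_mul x
  have h' := rpow_neg_three_half_mul x
  rw [kern₁, kern₂]
  linear_combination -h' + 3 * x ^ 2 * h

lemma abs_kern₁_le (x : ℝ) : |kern₁ x| ≤ kern x := by
  have hp := kern_pos x
  have h : (1 + x ^ 2) * |kern₁ x| = |x| * kern x := by
    rw [← abs_of_pos (one_add_sq_pos x), ← abs_mul, one_add_sq_mul_kern₁, abs_mul, abs_neg,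
      abs_of_pos hp]
  have hx : |x| ≤ 1 + x ^ 2 := by nlinarith [sq_abs x, sq_nonneg (|x| - 1), abs_nonneg x]
  have := mul_le_mul_of_nonneg_right hx hp.le
  exact le_of_mul_le_mul_left (by linarith) (one_add_sq_pos x)

lemma abs_kern₂_le (x : ℝ) : |kern₂ x| ≤ 4 * kern x := by
  have hp := kern_pos x
  have h1 := abs_kern₁_le x
  have hx : |x| ≤ 1 + x ^ 2 := by nlinarith [sq_abs x, sq_nonneg (|x| - 1), abs_nonneg x]
  have h : (1 + x ^ 2) * |kern₂ x| ≤ 3 * (|x| * |kern₁ x|) + kern x := by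
    rw [← abs_of_pos (one_add_sq_pos x), ← abs_mul, one_add_sq_mul_kern₂]
    refine (abs_sub _ _).trans ?_
    rw [abs_mul, abs_mul, abs_of_pos hp]; norm_num; linarith
  have h2 : |x| * |kern₁ x| ≤ (1 + x ^ 2) * kern x :=
    mul_le_mul hx h1 (abs_nonneg _) (one_add_sq_pos x).le
  have h3 : kern x ≤ (1 + x ^ 2) * kern x := by nlinarith [sq_nonneg x]
  exact le_of_mul_le_mul_left (by linarith) (one_add_sq_pos x)

lemma abs_mul_kern_le (x : ℝ) : |x| * kern x ≤ 1 := by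
  have h : kern x = (Real.sqrt (1 + x ^ 2))⁻¹ := by
    rw [kern, Real.rpow_neg (one_add_sq_pos x).le, Real.sqrt_eq_rpow]
  rw [h, ← div_eq_mul_inv, div_le_one (Real.sqrt_pos.2 (one_add_sq_pos x))]
  exact Real.abs_le_sqrt (by linarith)

lemma kern_le_one (x : ℝ) : kern x ≤ 1 :=
  Real.rpow_le_one_of_one_le_of_nonpos (by nlinarith [sq_nonneg x]) (by norm_num)

/-- Adds `kern ≤ 1` and `|x| * kern x ≤ 1`. The bound is integrable in `s` and locally uniform in
`z`, which is what differentiation under the integral requires. -/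
lemma kern_add_sq_le {M z : ℝ} (hz : |z| ≤ M) (s : ℝ) :
    kern (z + s ^ 2) ≤ (2 + M) * (1 + s ^ 2)⁻¹ := by
  rw [← div_eq_mul_inv, le_div_iff₀ (by positivity)]
  have hp := kern_pos (z + s ^ 2)
  have h1 := abs_mul_kern_le (z + s ^ 2)
  have h2 := kern_le_one (z + s ^ 2)
  have h3 : s ^ 2 ≤ |z + s ^ 2| + M := by
    linarith [le_abs_self (z + s ^ 2), neg_abs_le z]
  have hM : 0 ≤ M := (abs_nonneg z).trans hz
  have h4 : kern (z + s ^ 2) * s ^ 2 ≤ kern (z + s ^ 2) * (|z + s ^ 2| + M) :=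
    mul_le_mul_of_nonneg_left h3 hp.le
  nlinarith [mul_le_mul_of_nonneg_right h2 hM]

lemma integrable_of_abs_le_kern {k : ℝ → ℝ} (hk : Continuous k) {C : ℝ}
    (hb : ∀ x, |k x| ≤ C * kern x) (z : ℝ) : Integrable fun s : ℝ => k (z + s ^ 2) := by
  have hC : 0 ≤ C := by
    have := (abs_nonneg _).trans (hb 0)
    exact nonneg_of_mul_nonneg_left this (kern_pos 0)
  refine (integrable_inv_one_add_sq.const_mul (C * (2 + |z|))).mono'
    (by fun_prop) (Filter.Eventually.of_forall fun s => ?_)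
  rw [Real.norm_eq_abs, mul_assoc]
  exact (hb _).trans (mul_le_mul_of_nonneg_left (kern_add_sq_le le_rfl s) hC)

lemma hasDerivAt_integral_add_sq {k k' : ℝ → ℝ} (hk : ∀ x, HasDerivAt k (k' x) x)
    (hk' : Continuous k') {C C' : ℝ} (hb : ∀ x, |k x| ≤ C * kern x)
    (hb' : ∀ x, |k' x| ≤ C' * kern x) (z : ℝ) :
    HasDerivAt (fun z => ∫ s : ℝ, k (z + s ^ 2)) (∫ s : ℝ, k' (z + s ^ 2)) z := by
  have hkc : Continuous k := continuous_iff_continuousAt.2 fun x => (hk x).continuousAt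
  have hC : 0 ≤ C' := by
    have := (abs_nonneg _).trans (hb' 0)
    exact nonneg_of_mul_nonneg_left this (kern_pos 0)
  refine (hasDerivAt_integral_of_dominated_loc_of_deriv_le
    (F := fun z s : ℝ => k (z + s ^ 2)) (F' := fun z s : ℝ => k' (z + s ^ 2))
    (bound := fun s : ℝ => C' * (2 + (|z| + 1)) * (1 + s ^ 2)⁻¹)
    (Metric.ball_mem_nhds z one_pos)
    (Filter.Eventually.of_forall fun y => ?_) (integrable_of_abs_le_kern hkc hb z) ?_
    (Filter.Eventually.of_forall fun s y hy => ?_)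
    (integrable_inv_one_add_sq.const_mul _)
    (Filter.Eventually.of_forall fun s y _ => ?_)).2
  · exact (by fun_prop : Continuous fun s : ℝ => k (y + s ^ 2)).aestronglyMeasurable
  · exact (by fun_prop : Continuous fun s : ℝ => k' (z + s ^ 2)).aestronglyMeasurable
  · rw [Real.norm_eq_abs, mul_assoc]
    refine (hb' _).trans (mul_le_mul_of_nonneg_left (kern_add_sq_le ?_ s) hC)
    rw [Metric.mem_ball, Real.dist_eq] at hy
    have := abs_add_le (y - z) z
    rw [sub_add_cancel] at this
    linarith
  · simpa using (hk (y + s ^ 2)).comp_add_const y (s ^ 2)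

/-- The positive decreasing solution of `((1 + z²) f')' + f / 4 = 0`. -/
def prof (z : ℝ) : ℝ := ∫ s : ℝ, kern (z + s ^ 2)

/-- The derivative of `prof`. -/
def prof₁ (z : ℝ) : ℝ := ∫ s : ℝ, kern₁ (z + s ^ 2)

/-- The second derivative of `prof`. -/
def prof₂ (z : ℝ) : ℝ := ∫ s : ℝ, kern₂ (z + s ^ 2)

lemma abs_kern_le (x : ℝ) : |kern x| ≤ 1 * kern x := by rw [abs_of_pos (kern_pos x), one_mul]

lemma abs_kern₁_le' (x : ℝ) : |kern₁ x| ≤ 1 * kern x := by simpa using abs_kern₁_le x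

lemma hasDerivAt_prof (z : ℝ) : HasDerivAt prof (prof₁ z) z :=
  hasDerivAt_integral_add_sq hasDerivAt_kern continuous_kern₁ abs_kern_le abs_kern₁_le' z

lemma hasDerivAt_prof₁ (z : ℝ) : HasDerivAt prof₁ (prof₂ z) z :=
  hasDerivAt_integral_add_sq hasDerivAt_kern₁ continuous_kern₂ abs_kern₁_le' abs_kern₂_le z

lemma integrable_kern (z : ℝ) : Integrable fun s : ℝ => kern (z + s ^ 2) :=
  integrable_of_abs_le_kern continuous_kern abs_kern_le z

lemma integrable_kern₁ (z : ℝ) : Integrable fun s : ℝ => kern₁ (z + s ^ 2) :=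
  integrable_of_abs_le_kern continuous_kern₁ abs_kern₁_le' z

lemma integrable_kern₂ (z : ℝ) : Integrable fun s : ℝ => kern₂ (z + s ^ 2) :=
  integrable_of_abs_le_kern continuous_kern₂ abs_kern₂_le z

lemma prof_pos (z : ℝ) : 0 < prof z := by
  rw [prof, integral_pos_iff_support_of_nonneg (fun s => (kern_pos _).le) (integrable_kern z)]
  have : Function.support (fun s : ℝ => kern (z + s ^ 2)) = Set.univ :=
    Set.eq_univ_of_forall fun s => (kern_pos _).ne'
  rw [this]; simp

lemma prof₁_nonpos {z : ℝ} (hz : 0 ≤ z) : prof₁ z ≤ 0 := by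
  refine integral_nonpos fun s => ?_
  have : 0 ≤ (z + s ^ 2) * (1 + (z + s ^ 2) ^ 2) ^ (-(3 / 2) : ℝ) := by positivity
  simp only [kern₁, Pi.zero_apply]; linarith

/-- A primitive in `s` of `(1 + z²) k'' + 2 z k' + k / 4` at `z + s²`, with `k = kern`. -/
def kernPrim (z s : ℝ) : ℝ :=
  s * (-(3 / 4) * kern (z + s ^ 2) + (s ^ 2 / 2 - (z + s ^ 2)) * kern₁ (z + s ^ 2))

/-- The operator of the ODE in `z`, applied to the integrand, is a total derivative in `s`. The only
input is the second-order equation `one_add_sq_mul_kern₂` for `kern`. -/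
lemma hasDerivAt_kernPrim (z s : ℝ) :
    HasDerivAt (kernPrim z) ((1 + z ^ 2) * kern₂ (z + s ^ 2) + 2 * z * kern₁ (z + s ^ 2)
      + 1 / 4 * kern (z + s ^ 2)) s := by
  have hX : HasDerivAt (fun s : ℝ => z + s ^ 2) (2 * s) s := by
    simpa using (hasDerivAt_pow 2 s).const_add z
  have hs : HasDerivAt (fun s : ℝ => s ^ 2 / 2) s s := by
    convert! (hasDerivAt_pow 2 s).div_const 2 using 1; norm_num
  have h0 := (hasDerivAt_kern (z + s ^ 2)).comp s hX
  have h1 := (hasDerivAt_kern₁ (z + s ^ 2)).comp s hX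
  have := (hasDerivAt_id s).mul ((h0.const_mul (-(3 / 4))).add ((hs.sub hX).mul h1))
  refine this.congr_deriv ?_
  have e := one_add_sq_mul_kern₂ (z + s ^ 2)
  simp only [id, Function.comp_apply, Pi.sub_apply, Pi.add_apply, Pi.mul_apply]
  linear_combination -e

lemma abs_kernPrim_le (z s : ℝ) : |kernPrim z s| ≤ (2 + |z|) * ((2 + |z|) * |s * (1 + s ^ 2)⁻¹|) := by
  have hp := kern_pos (z + s ^ 2)
  have h0 := kern_add_sq_le (le_refl |z|) s
  have h1 : |(s ^ 2 / 2 - (z + s ^ 2)) * kern₁ (z + s ^ 2)| ≤ (1 + |z|) * kern (z + s ^ 2) := by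
    have e : |(s ^ 2 / 2 - (z + s ^ 2))| ≤ |z + s ^ 2| + |z| := by
      rw [abs_le]
      constructor
      · linarith [le_abs_self (z + s ^ 2), abs_nonneg z, sq_nonneg s]
      · linarith [neg_abs_le (z + s ^ 2), neg_abs_le z, sq_nonneg s, abs_nonneg (z + s ^ 2)]
    have e1 : |z + s ^ 2| * |kern₁ (z + s ^ 2)| ≤ kern (z + s ^ 2) := by
      set x := z + s ^ 2
      have h : (1 + x ^ 2) * |kern₁ x| = |x| * kern x := by
        rw [← abs_of_pos (one_add_sq_pos x), ← abs_mul, one_add_sq_mul_kern₁, abs_mul, abs_neg,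
          abs_of_pos hp]
      have : (1 + x ^ 2) * (|x| * |kern₁ x|) = x ^ 2 * kern x := by
        rw [← sq_abs x] at h ⊢; linear_combination |x| * h
      refine le_of_mul_le_mul_left ?_ (one_add_sq_pos x)
      rw [this]; linarith
    rw [abs_mul]
    refine (mul_le_mul_of_nonneg_right e (abs_nonneg _)).trans ?_
    rw [add_mul, add_mul, one_mul]
    exact add_le_add e1 (mul_le_mul_of_nonneg_left (abs_kern₁_le _) (abs_nonneg z))
  rw [kernPrim, abs_mul]
  have h2 : |-(3 / 4) * kern (z + s ^ 2) + (s ^ 2 / 2 - (z + s ^ 2)) * kern₁ (z + s ^ 2)|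
      ≤ (2 + |z|) * kern (z + s ^ 2) := by
    refine (abs_add_le _ _).trans ?_
    rw [abs_mul, abs_of_pos hp]
    norm_num
    rw [abs_mul] at h1
    linarith
  rw [abs_mul, abs_of_pos (inv_pos.2 (one_add_sq_pos s))]
  calc |s| * _ ≤ |s| * ((2 + |z|) * ((2 + |z|) * (1 + s ^ 2)⁻¹)) := by
        refine mul_le_mul_of_nonneg_left (h2.trans ?_) (abs_nonneg s)
        exact mul_le_mul_of_nonneg_left h0 (by positivity)
    _ = _ := by ring

lemma tendsto_kernPrim (z : ℝ) {l : Filter ℝ} (hl : Filter.Tendsto (fun s : ℝ => |s|) l .atTop) :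
    Filter.Tendsto (kernPrim z) l (nhds 0) := by
  have h : Filter.Tendsto (fun s : ℝ => |s * (1 + s ^ 2)⁻¹|) l (nhds 0) := by
    refine squeeze_zero (fun s => abs_nonneg _) (fun s => ?_) (tendsto_inv_atTop_zero.comp hl)
    rw [Function.comp_apply, abs_mul, abs_of_pos (inv_pos.2 (one_add_sq_pos s))]
    rcases eq_or_ne s 0 with rfl | hs
    · simp
    · have hs' := abs_pos.2 hs
      rw [← div_eq_mul_inv, ← one_div, div_le_div_iff₀ (one_add_sq_pos s) hs', one_mul,
        ← sq, sq_abs]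
      linarith
  refine squeeze_zero_norm (abs_kernPrim_le z) ?_
  simpa using (h.const_mul (2 + |z|)).const_mul (2 + |z|)

/-- The integrand is the `s`-derivative of `kernPrim z`, which vanishes at both ends of the line. -/
lemma prof_ode (z : ℝ) : (1 + z ^ 2) * prof₂ z + 2 * z * prof₁ z + 1 / 4 * prof z = 0 := by
  have i0 := (integrable_kern z).const_mul (1 / 4)
  have i1 := (integrable_kern₁ z).const_mul (2 * z)
  have i2 := (integrable_kern₂ z).const_mul (1 + z ^ 2)
  have := integral_of_hasDerivAt_of_tendsto (hasDerivAt_kernPrim z) ((i2.add i1).add i0)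
    (tendsto_kernPrim z Filter.tendsto_abs_atBot_atTop)
    (tendsto_kernPrim z Filter.tendsto_abs_atTop_atTop)
  rw [integral_add (by exact i2.add i1) i0, integral_add i2 i1, integral_const_mul, integral_const_mul,
    integral_const_mul, sub_zero] at this
  exact this

/-! ### The constant -/

/-- A Beta integral over the half-line. -/
lemma integral_rpow_mul_one_add_rpow_mul_Gamma {a p s : ℝ} (ha : -1 < a) (hp : 0 < p)
    (hs : (a + 1) / p < s) :
    (∫ x in Set.Ioi (0 : ℝ), x ^ a * (1 + x ^ p) ^ (-s)) * Real.Gamma s =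
      1 / p * Real.Gamma ((a + 1) / p) * Real.Gamma (s - (a + 1) / p) := by
  set q := (a + 1) / p with hq
  have hq0 : 0 < q := div_pos (by linarith) hp
  have hs0 : 0 < s := hq0.trans hs
  -- Expands `Γ(s)(1+x^p)^(-s)` as an integral over `y`; Fubini then makes the inner `x`-integral a
  -- Gamma integral.
  set F : ℝ → ℝ → ℝ := fun y x => y ^ (s - 1) * (x ^ a * Real.exp (-y * (1 + x ^ p))) with hF
  have hFe : ∀ y x : ℝ, F y x
      = y ^ (s - 1) * Real.exp (-y) * (x ^ a * Real.exp (-y * x ^ p)) := by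
    intro y x
    rw [hF]
    have : -y * (1 + x ^ p) = -y + -y * x ^ p := by ring
    simp only [this, Real.exp_add]; ring
  have hinner : ∀ y ∈ Set.Ioi (0 : ℝ), ∫ x in Set.Ioi (0 : ℝ), F y x
      = (1 / p * Real.Gamma q) * (Real.exp (-y) * y ^ (s - q - 1)) := by
    intro y hy
    have hy' : 0 < y := hy
    simp_rw [hFe]
    rw [integral_const_mul, integral_rpow_mul_exp_neg_mul_rpow hp ha hy', ← hq,
      show -(a + 1) / p = -q by rw [hq]; ring, show s - q - 1 = (s - 1) + -q by ring,
      Real.rpow_add hy']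
    ring
  have hint : Integrable (Function.uncurry F)
      ((volume.restrict (Set.Ioi (0 : ℝ))).prod (volume.restrict (Set.Ioi (0 : ℝ)))) := by
    have hm : Measurable (Function.uncurry F) := by
      rw [hF]; unfold Function.uncurry; fun_prop
    rw [integrable_prod_iff hm.aestronglyMeasurable]
    constructor
    · filter_upwards [ae_restrict_mem measurableSet_Ioi] with y hy
      simp only [Function.uncurry, hFe]
      exact (integrableOn_rpow_mul_exp_neg_mul_rpow ha hp hy).const_mul _
    · refine ((Real.GammaIntegral_convergent (sub_pos.2 hs)).const_mul
        (1 / p * Real.Gamma q)).congr ?_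
      filter_upwards [ae_restrict_mem measurableSet_Ioi] with y hy
      rw [← hinner y hy]
      refine setIntegral_congr_fun measurableSet_Ioi fun x hx => ?_
      have hx' : 0 < x := hx
      have hy' : 0 < y := hy
      have : 0 ≤ F y x := by rw [hF]; positivity
      simp only [Function.uncurry, Real.norm_eq_abs, abs_of_nonneg this]
  have hswap := integral_integral_swap hint
  rw [setIntegral_congr_fun measurableSet_Ioi hinner, integral_const_mul,
    ← Real.Gamma_eq_integral (sub_pos.2 hs)] at hswap
  rw [hswap, ← integral_mul_const]
  refine setIntegral_congr_fun measurableSet_Ioi fun x hx => ?_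
  have hx' : 0 < x := hx
  have hr : 0 < 1 + x ^ p := by positivity
  have := Real.integral_rpow_mul_exp_neg_mul_Ioi hs0 hr
  have e : ∀ y, F y x = x ^ a * (y ^ (s - 1) * Real.exp (-((1 + x ^ p) * y))) := by
    intro y
    rw [hF, show -((1 + x ^ p) * y) = -y * (1 + x ^ p) by ring]; ring
  simp_rw [e]
  rw [integral_const_mul, this, one_div, Real.inv_rpow hr.le, Real.rpow_neg hr.le]
  ring

lemma integral_eq_two_mul_Ioi_of_even {h : ℝ → ℝ} (he : ∀ x, h (-x) = h x) :
    ∫ x, h x = 2 * ∫ x in Set.Ioi (0 : ℝ), h x := by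
  rw [← integral_comp_abs]
  congr 1; ext x
  rcases abs_choice x with hx | hx <;> rw [hx]
  rw [he]

lemma prof_zero_mul :
    prof 0 * Real.Gamma (1 / 2) = 1 / 2 * (Real.Gamma (1 / 4) * Real.Gamma (1 / 4)) := by
  have h := integral_rpow_mul_one_add_rpow_mul_Gamma (a := 0) (p := 4) (s := 1 / 2)
    (by norm_num) (by norm_num) (by norm_num)
  have e : prof 0 = 2 * ∫ x in Set.Ioi (0 : ℝ), x ^ (0 : ℝ) * (1 + x ^ (4 : ℝ)) ^ (-(1 / 2) : ℝ) := by
    rw [prof, integral_eq_two_mul_Ioi_of_even (fun x => by rw [neg_sq])]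
    congr 1
    refine setIntegral_congr_fun measurableSet_Ioi fun x _ => ?_
    have : x ^ (4 : ℝ) = (0 + x ^ 2) ^ 2 := by
      rw [show (4 : ℝ) = (4 : ℕ) by norm_num, Real.rpow_natCast]; ring
    simp only [kern, this, Real.rpow_zero, one_mul]
  rw [e, mul_assoc, h]; norm_num; ring

lemma prof₁_zero_mul :
    prof₁ 0 * Real.Gamma (3 / 2) = -(1 / 2 * (Real.Gamma (3 / 4) * Real.Gamma (3 / 4))) := by
  have h := integral_rpow_mul_one_add_rpow_mul_Gamma (a := 2) (p := 4) (s := 3 / 2)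
    (by norm_num) (by norm_num) (by norm_num)
  have e : prof₁ 0
      = -(2 * ∫ x in Set.Ioi (0 : ℝ), x ^ (2 : ℝ) * (1 + x ^ (4 : ℝ)) ^ (-(3 / 2) : ℝ)) := by
    rw [prof₁, integral_eq_two_mul_Ioi_of_even (fun x => by rw [neg_sq]), ← mul_neg,
      ← integral_neg]
    congr 1
    refine setIntegral_congr_fun measurableSet_Ioi fun x _ => ?_
    have h4 : x ^ (4 : ℝ) = (0 + x ^ 2) ^ 2 := by
      rw [show (4 : ℝ) = (4 : ℕ) by norm_num, Real.rpow_natCast]; ring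
    simp only [kern₁, h4, Real.rpow_two]; ring
  rw [e, neg_mul, mul_assoc, h]; norm_num; ring

/-- Since `Γ(3/2) = Γ(1/2)/2`, the factor `Γ(1/2)` cancels in the quotient of the two Beta
integrals. -/
lemma neg_prof₁_div_prof_zero :
    -prof₁ 0 / prof 0 = 2 * (Real.Gamma (3 / 4) / Real.Gamma (1 / 4)) ^ 2 := by
  have h0 := prof_zero_mul
  have h1 := prof₁_zero_mul
  have hG : Real.Gamma (3 / 2) = 1 / 2 * Real.Gamma (1 / 2) := by
    rw [show (3 / 2 : ℝ) = 1 / 2 + 1 by norm_num, Real.Gamma_add_one (by norm_num)]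
  have p0 := prof_pos 0
  have p1 : 0 < Real.Gamma (1 / 2) := Real.Gamma_pos_of_pos (by norm_num)
  have p2 : 0 < Real.Gamma (1 / 4) := Real.Gamma_pos_of_pos (by norm_num)
  rw [hG] at h1
  rw [div_pow, mul_div_assoc', div_eq_div_iff p0.ne' (by positivity)]
  refine mul_right_cancel₀ p1.ne' ?_
  linear_combination (-2 * Real.Gamma (1 / 4) ^ 2) * h1 - 2 * Real.Gamma (3 / 4) ^ 2 * h0

/-! ### The Riccati equation -/

/-- Minus the logarithmic derivative of `prof`. -/
def ric (z : ℝ) : ℝ := -prof₁ z / prof z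

/-- The derivative of `ric`. -/
def ric₁ (z : ℝ) : ℝ := -prof₂ z / prof z + ric z ^ 2

lemma hasDerivAt_ric (z : ℝ) : HasDerivAt ric (ric₁ z) z := by
  have hp := (prof_pos z).ne'
  refine ((hasDerivAt_prof₁ z).neg.div (hasDerivAt_prof z) hp).congr_deriv ?_
  rw [ric₁, ric]; simp only [Pi.neg_apply]; field_simp; ring

lemma ric_ode (z : ℝ) : (1 + z ^ 2) * (ric₁ z - ric z ^ 2) + 2 * z * ric z = 1 / 4 := by
  have hp := (prof_pos z).ne'
  have h := prof_ode z
  rw [ric₁, ric]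
  field_simp
  linear_combination (-4 * prof z) * h

lemma continuous_ric : Continuous ric :=
  continuous_iff_continuousAt.2 fun z => (hasDerivAt_ric z).continuousAt

/-- The Riccati equation expresses `ric₁` through `ric`, so continuity of `prof₂` is not needed. -/
lemma continuous_ric₁ : Continuous ric₁ := by
  have h : ric₁ = fun z => ric z ^ 2 + (1 / 4 - 2 * z * ric z) / (1 + z ^ 2) := by
    ext z
    have := (one_add_sq_pos z).ne'
    rw [← ric_ode z]; field_simp; ring
  have := continuous_ric
  rw [h]
  exact (this.pow 2).add (Continuous.div (by fun_prop) (by fun_prop)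
    fun z => (one_add_sq_pos z).ne')

lemma ric_nonneg {z : ℝ} (hz : 0 ≤ z) : 0 ≤ ric z :=
  div_nonneg (neg_nonneg.2 (prof₁_nonpos hz)) (prof_pos z).le

lemma ric_zero : ric 0 = 2 * (Real.Gamma (3 / 4) / Real.Gamma (1 / 4)) ^ 2 :=
  neg_prof₁_div_prof_zero

/-! ### The one-dimensional inequality in `t` -/

/-- The coefficient of the potential coming from the `t`-derivative. -/
def potT (z : ℝ) : ℝ := ric₁ z - ric z ^ 2

/-- The coefficient of the potential coming from the `x`-gradient. -/
def potX (z : ℝ) : ℝ := 2 * z * ric z + z ^ 2 * potT z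

lemma continuous_potT : Continuous potT := continuous_ric₁.sub (continuous_ric.pow 2)

lemma continuous_potX : Continuous potX := by
  have := continuous_potT
  have := continuous_ric
  unfold potX; fun_prop

lemma potX_add_potT (z : ℝ) : potX z + potT z = 1 / 4 := by
  rw [potX, potT, ← ric_ode z]; ring

/-- Integrates `(v' + v·g(t/r)/r)² ≥ 0`. The cross term combines with part of the potential into the
derivative of `v²·g(t/r)/r`, whose boundary value at `0` is the trace term. -/
lemma half_line_inequality {v : ℝ → ℝ} (hv : ContDiff ℝ 1 v) (hc : HasCompactSupport v)
    {r : ℝ} (hr : 0 < r) :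
    (∫ t in Set.Ioi (0 : ℝ), v t ^ 2 * (potT (t / r) / r ^ 2)) + v 0 ^ 2 * (ric 0 / r)
      ≤ ∫ t in Set.Ioi (0 : ℝ), deriv v t ^ 2 := by
  have hd : ∀ t, HasDerivAt v (deriv v t) t := fun t =>
    (hv.differentiable one_ne_zero t).hasDerivAt
  have hdc : Continuous (deriv v) := hv.continuous_deriv le_rfl
  have hvc : Continuous v := hv.continuous
  have hg := continuous_ric
  have hg1 := continuous_ric₁
  have hpT := continuous_potT
  set F : ℝ → ℝ := fun t => v t ^ 2 * (ric (t / r) / r) with hF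
  set F' : ℝ → ℝ := fun t =>
    v t * (2 * deriv v t * (ric (t / r) / r) + v t * (ric₁ (t / r) / r ^ 2)) with hF'
  have hder : ∀ t, HasDerivAt F (F' t) t := by
    intro t
    have h1 : HasDerivAt (fun t => t / r) (1 / r) t := (hasDerivAt_id t).div_const r
    have h2 := ((hasDerivAt_ric (t / r)).comp t h1).div_const r
    refine (((hd t).pow 2).mul h2).congr_deriv ?_
    simp only [hF', Function.comp_apply, Pi.pow_apply]
    field_simp; push_cast; ring
  have hF'i : Integrable F' :=
    Continuous.integrable_of_hasCompactSupport (by fun_prop) (hc.mul_right)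
  have hFc : HasCompactSupport F := by
    have : F = fun t => v t * (v t * (ric (t / r) / r)) := by ext; simp only [hF]; ring
    rw [this]; exact hc.mul_right
  have htend : Filter.Tendsto F Filter.atTop (nhds 0) :=
    (hFc.is_zero_at_infty).mono_left atTop_le_cocompact
  have hI := integral_Ioi_of_hasDerivAt_of_tendsto (a := 0)
    (hder 0).continuousAt.continuousWithinAt (fun x _ => hder x) hF'i.integrableOn htend
  have hi1 : Integrable fun t => v t ^ 2 * (potT (t / r) / r ^ 2) :=
    Continuous.integrable_of_hasCompactSupport (by fun_prop) (by
      simp_rw [sq (v _), mul_assoc]; exact hc.mul_right)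
  have hi2 : Integrable fun t => deriv v t ^ 2 :=
    Continuous.integrable_of_hasCompactSupport (by fun_prop) (by
      simp_rw [sq]; exact hc.deriv.mul_right)
  have hmono : ∫ t in Set.Ioi (0 : ℝ), (v t ^ 2 * (potT (t / r) / r ^ 2) - F' t)
      ≤ ∫ t in Set.Ioi (0 : ℝ), deriv v t ^ 2 := by
    refine setIntegral_mono (hi1.sub hF'i).integrableOn hi2.integrableOn fun t => ?_
    have : deriv v t ^ 2 - (v t ^ 2 * (potT (t / r) / r ^ 2) - F' t)
        = (deriv v t + v t * (ric (t / r) / r)) ^ 2 := by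
      simp only [hF', potT]; field_simp; ring
    nlinarith [sq_nonneg (deriv v t + v t * (ric (t / r) / r))]
  rw [integral_sub hi1.integrableOn hF'i.integrableOn, hI] at hmono
  simp only [hF, zero_div] at hmono
  linarith

/-- The half-line inequality for `v` and its reflection; the two boundary terms at `0` add up to `2
* ric 0`. -/
lemma line_inequality {v : ℝ → ℝ} (hv : ContDiff ℝ 1 v) (hc : HasCompactSupport v)
    {r : ℝ} (hr : 0 < r) :
    (∫ t, v t ^ 2 * (potT (|t| / r) / r ^ 2)) + v 0 ^ 2 * (2 * ric 0 / r)
      ≤ ∫ t, deriv v t ^ 2 := by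
  have hpT := continuous_potT
  have hvc := hv.continuous
  have hdc : Continuous (deriv v) := hv.continuous_deriv le_rfl
  have hi1 : Integrable fun t => v t ^ 2 * (potT (|t| / r) / r ^ 2) :=
    Continuous.integrable_of_hasCompactSupport (by fun_prop) (by
      simp_rw [sq (v _), mul_assoc]; exact hc.mul_right)
  have hi2 : Integrable fun t => deriv v t ^ 2 :=
    Continuous.integrable_of_hasCompactSupport (by fun_prop) (by
      simp_rw [sq]; exact hc.deriv.mul_right)
  have hsplit : ∀ {h : ℝ → ℝ}, Integrable h →
      ∫ t, h t = (∫ t in Set.Ioi (0 : ℝ), h (-t)) + ∫ t in Set.Ioi (0 : ℝ), h t := by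
    intro h hh
    rw [integral_comp_neg_Ioi, neg_zero]
    exact (intervalIntegral.integral_Iic_add_Ioi hh.integrableOn hh.integrableOn).symm
  have h1 := half_line_inequality hv hc hr
  have h2 := half_line_inequality (v := fun t => v (-t)) (hv.comp contDiff_neg)
    (hc.comp_homeomorph (Homeomorph.neg ℝ)) hr
  have e : ∀ t : ℝ, deriv (fun t => v (-t)) t ^ 2 = deriv v (-t) ^ 2 := by
    intro t; rw [deriv_comp_neg, neg_sq]
  simp_rw [e, neg_zero] at h2
  rw [hsplit hi1, hsplit hi2]
  have e1 : ∫ t in Set.Ioi (0 : ℝ), v t ^ 2 * (potT (|t| / r) / r ^ 2)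
      = ∫ t in Set.Ioi (0 : ℝ), v t ^ 2 * (potT (t / r) / r ^ 2) :=
    setIntegral_congr_fun measurableSet_Ioi fun t ht => by
      simp only [abs_of_pos (show (0 : ℝ) < t from ht)]
  have e2 : ∫ t in Set.Ioi (0 : ℝ), v (-t) ^ 2 * (potT (|(-t)| / r) / r ^ 2)
      = ∫ t in Set.Ioi (0 : ℝ), v (-t) ^ 2 * (potT (t / r) / r ^ 2) :=
    setIntegral_congr_fun measurableSet_Ioi fun t ht => by
      simp only [abs_neg, abs_of_pos (show (0 : ℝ) < t from ht)]
  rw [e1, e2]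
  have : v 0 ^ 2 * (2 * ric 0 / r) = v 0 ^ 2 * (ric 0 / r) + v 0 ^ 2 * (ric 0 / r) := by ring
  linarith

/-! ### Weak superharmonicity tested against Lipschitz functions -/

section Weak

open scoped NNReal Convolution

lemma lineDeriv_eq_zero_of_notMem_tsupport {E : Type*} [NormedAddCommGroup E]
    [NormedSpace ℝ E] {f : E → ℝ} {x : E} (hx : x ∉ tsupport f) (e : E) :
    lineDeriv ℝ f x e = 0 := by
  have h : f =ᶠ[nhds x] fun _ => 0 := notMem_tsupport_iff_eventuallyEq.1 hx
  rw [h.lineDeriv_eq]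
  simp [lineDeriv]

variable {E : Type*} [NormedAddCommGroup E] [InnerProductSpace ℝ E] [FiniteDimensional ℝ E]
  [MeasurableSpace E] [BorelSpace E]

lemma integrable_of_bounded_of_tsupport {f : E → ℝ} {K : Set E} (hK : IsCompact K)
    (hf : AEStronglyMeasurable f) {C : ℝ} (hC : ∀ x, ‖f x‖ ≤ C) (h0 : ∀ x ∉ K, f x = 0) :
    Integrable f := by
  have h : IntegrableOn f K := Measure.integrableOn_of_bounded hK.measure_lt_top.ne hf
    (Filter.Eventually.of_forall hC)
  refine (integrableOn_iff_integrable_of_support_subset fun x hx => ?_).1 h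
  by_contra hxK
  exact hx (h0 x hxK)

lemma integrable_lineDeriv_mul_lineDeriv {d ψ : E → ℝ} {L C : ℝ≥0} (hd : LipschitzWith L d)
    (hψ : LipschitzWith C ψ) (hc : HasCompactSupport ψ) (e : E) :
    Integrable fun x => lineDeriv ℝ d x e * lineDeriv ℝ ψ x e := by
  refine integrable_of_bounded_of_tsupport hc
    ((measurable_lineDeriv hd.continuous).mul
      (measurable_lineDeriv hψ.continuous)).aestronglyMeasurable
    (C := (L * ‖e‖) * (C * ‖e‖)) (fun x => ?_) fun x hx => ?_
  · rw [norm_mul]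
    exact mul_le_mul (norm_lineDeriv_le_of_lipschitz ℝ hd) (norm_lineDeriv_le_of_lipschitz ℝ hψ)
      (norm_nonneg _) (by positivity)
  · rw [lineDeriv_eq_zero_of_notMem_tsupport hx, mul_zero]

lemma integral_inner_gradient {d ψ : E → ℝ} {L C : ℝ≥0} (hd : LipschitzWith L d)
    (hψ : LipschitzWith C ψ) (hc : HasCompactSupport ψ) {ι : Type*} [Fintype ι]
    (b : OrthonormalBasis ι ℝ E) :
    ∫ x, inner ℝ (∇ d x) (∇ ψ x) = ∑ i, ∫ x, lineDeriv ℝ d x (b i) * lineDeriv ℝ ψ x (b i) := by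
  rw [← integral_finsetSum _ fun i _ => integrable_lineDeriv_mul_lineDeriv hd hψ hc (b i)]
  refine integral_congr_ae ?_
  filter_upwards [hd.ae_differentiableAt (μ := volume), hψ.ae_differentiableAt (μ := volume)]
    with x hx hx'
  rw [← b.sum_inner_mul_inner]
  refine Finset.sum_congr rfl fun i _ => ?_
  rw [hx.lineDeriv_eq_fderiv, hx'.lineDeriv_eq_fderiv, inner_gradient_left, real_inner_comm,
    inner_gradient_left]

/-- As `d` is only Lipschitz, exactly one derivative is moved off `φ`. Line derivatives are used
because integration by parts for Lipschitz functions is available in that form. -/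
lemma integral_mul_neg_laplacian {d φ : E → ℝ} {L : ℝ≥0} (hd : LipschitzWith L d)
    (hφ : ContDiff ℝ ∞ φ) (hc : HasCompactSupport φ) {ι : Type*} [Fintype ι]
    (b : OrthonormalBasis ι ℝ E) :
    ∫ x, d x * (-(Δ φ) x) = ∑ i, ∫ x, lineDeriv ℝ d x (b i) * lineDeriv ℝ φ x (b i) := by
  have hsm : ∀ i, ContDiff ℝ ∞ fun x => fderiv ℝ φ x (b i) := fun i =>
    (hφ.fderiv_right (m := ∞) (by simp)).clm_apply contDiff_const
  have hcs : ∀ i, HasCompactSupport fun x => fderiv ℝ φ x (b i) := fun i => hc.fderiv_apply ℝ _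
  have hLap : ∀ x, d x * (-(Δ φ) x)
      = ∑ i, fderiv ℝ (fun y => fderiv ℝ φ y (b i)) x (-(b i)) * d x := by
    intro x
    rw [InnerProductSpace.laplacian_eq_iteratedFDeriv_orthonormalBasis φ b, mul_comm, neg_mul,
      Finset.sum_mul, ← Finset.sum_neg_distrib]
    refine Finset.sum_congr rfl fun i _ => ?_
    rw [iteratedFDeriv_two_apply, map_neg, neg_mul]
    congr 2
    have hdiff : DifferentiableAt ℝ (fderiv ℝ φ) x :=
      ((hφ.fderiv_right (m := ∞) (by simp)).differentiable (by simp)) x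
    rw [fderiv_clm_apply hdiff (differentiableAt_const _)]
    simp
  simp_rw [hLap]
  rw [integral_finsetSum]
  · refine Finset.sum_congr rfl fun i _ => ?_
    obtain ⟨D, hD⟩ := (hsm i).lipschitzWith_of_hasCompactSupport (hcs i) (by simp)
    have := LipschitzWith.integral_lineDeriv_mul_eq (μ := volume) hd hD (hcs i) (b i)
    have e : ∀ x, lineDeriv ℝ φ x (b i) = fderiv ℝ φ x (b i) := fun x =>
      (hφ.differentiable (by simp) x).lineDeriv_eq_fderiv
    simp_rw [e]
    rw [this]
    refine integral_congr_ae (Filter.Eventually.of_forall fun x => ?_)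
    simp only
    rw [((hsm i).differentiable (by simp) x).lineDeriv_eq_fderiv]
  · intro i _
    refine Continuous.integrable_of_hasCompactSupport ?_ ?_
    · exact (((hsm i).continuous_fderiv (by simp)).clm_apply continuous_const).mul hd.continuous
    · exact ((hcs i).fderiv_apply ℝ _).mul_right

/-- A mollification of `ψ`. -/
def mollify (φ : ContDiffBump (0 : E)) (ψ : E → ℝ) : E → ℝ :=
  convolution (φ.normed volume) ψ (ContinuousLinearMap.lsmul ℝ ℝ) volume

lemma contDiff_mollify (φ : ContDiffBump (0 : E)) {ψ : E → ℝ} (hψ : Continuous ψ) :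
    ContDiff ℝ ∞ (mollify φ ψ) :=
  HasCompactSupport.contDiff_convolution_left _ φ.hasCompactSupport_normed φ.contDiff_normed
    hψ.locallyIntegrable

lemma tsupport_mollify_subset (φ : ContDiffBump (0 : E)) {ψ : E → ℝ} :
    tsupport (mollify φ ψ) ⊆ Metric.cthickening φ.rOut (tsupport ψ) := by
  refine closure_minimal ?_ Metric.isClosed_cthickening
  refine (support_convolution_subset _).trans ?_
  rintro _ ⟨y, hy, z, hz, rfl⟩
  rw [φ.support_normed_eq, mem_ball_zero_iff] at hy
  refine Metric.mem_cthickening_of_dist_le _ z _ _ (subset_tsupport _ hz) ?_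
  simp [hy.le]

lemma mollify_nonneg (φ : ContDiffBump (0 : E)) {ψ : E → ℝ} (h : ∀ x, 0 ≤ ψ x) (x : E) :
    0 ≤ mollify φ ψ x :=
  integral_nonneg fun y => mul_nonneg (φ.nonneg_normed y) (h _)

lemma lineDeriv_mollify (φ : ContDiffBump (0 : E)) {ψ : E → ℝ} {C : ℝ≥0}
    (hψ : LipschitzWith C ψ) (x e : E) :
    lineDeriv ℝ (mollify φ ψ) x e
      = convolution (φ.normed volume) (fun y => lineDeriv ℝ ψ y e)
          (ContinuousLinearMap.lsmul ℝ ℝ) volume x := by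
  have hρc : HasCompactSupport (φ.normed (volume : Measure E)) := φ.hasCompactSupport_normed
  have hρ : ContDiff ℝ 1 (φ.normed (volume : Measure E)) := φ.contDiff_normed
  obtain ⟨D, hD⟩ := hρ.lipschitzWith_of_hasCompactSupport hρc (by simp)
  have h1 := hρc.hasFDerivAt_convolution_left (ContinuousLinearMap.lsmul ℝ ℝ) hρ
    (hψ.continuous.locallyIntegrable (μ := (volume : Measure E))) x
  have hshift : LipschitzWith C fun y => ψ (x - y) := by
    refine LipschitzWith.of_dist_le_mul fun y z => ?_
    exact (hψ.dist_le_mul (x - y) (x - z)).trans_eq (by rw [dist_sub_left])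
  -- The direction is `-e` because `y ↦ ψ (x - y)` reverses orientation; this moves the derivative
  -- from the bump onto `ψ`.
  have h2 := LipschitzWith.integral_lineDeriv_mul_eq (μ := volume) hshift hD hρc (-e)
  have h3 : lineDeriv ℝ (mollify φ ψ) x e = ∫ y, fderiv ℝ (φ.normed volume) y e * ψ (x - y) := by
    have hex : ConvolutionExistsAt (fderiv ℝ (φ.normed (volume : Measure E))) ψ x
        (ContinuousLinearMap.precompL E (ContinuousLinearMap.lsmul ℝ ℝ)) volume :=
      (hρc.fderiv ℝ).convolutionExists_left _ (hρ.continuous_fderiv (by simp))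
        hψ.continuous.locallyIntegrable x
    rw [mollify, h1.differentiableAt.lineDeriv_eq_fderiv, h1.fderiv, convolution,
      ContinuousLinearMap.integral_apply hex]
    rfl
  rw [h3, convolution]
  have h4 : ∀ y, lineDeriv ℝ (φ.normed volume) y (- -e) = fderiv ℝ (φ.normed volume) y e := by
    intro y
    rw [neg_neg, (hρ.differentiable (by simp) y).lineDeriv_eq_fderiv]
  simp_rw [h4] at h2
  rw [← h2]
  refine integral_congr_ae (Filter.Eventually.of_forall fun y => ?_)
  have : lineDeriv ℝ (fun y => ψ (x - y)) y (-e) = lineDeriv ℝ ψ (x - y) e := by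
    simp only [lineDeriv]
    congr 1; ext t; congr 1; module
  simp only [this, ContinuousLinearMap.lsmul_apply, smul_eq_mul]
  ring

lemma norm_lineDeriv_mollify_le (φ : ContDiffBump (0 : E)) {ψ : E → ℝ} {C : ℝ≥0}
    (hψ : LipschitzWith C ψ) (x e : E) : ‖lineDeriv ℝ (mollify φ ψ) x e‖ ≤ C * ‖e‖ := by
  rw [lineDeriv_mollify φ hψ, convolution]
  have h : ∫ y, φ.normed volume y * (C * ‖e‖) = C * ‖e‖ := by
    rw [integral_mul_const, φ.integral_normed, one_mul]
  rw [← h]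
  refine norm_integral_le_of_norm_le (φ.integrable_normed.mul_const _)
    (Filter.Eventually.of_forall fun y => ?_)
  rw [ContinuousLinearMap.lsmul_apply, norm_smul, Real.norm_of_nonneg (φ.nonneg_normed y)]
  exact mul_le_mul_of_nonneg_left (norm_lineDeriv_le_of_lipschitz ℝ hψ) (φ.nonneg_normed y)

/-- Dominated convergence: the Lipschitz bounds dominate on the unit thickening of the support, and
the mollified derivatives converge almost everywhere by Lebesgue differentiation, for which the
ratio of the two bump radii must stay bounded. -/
lemma tendsto_integral_lineDeriv_mollify {d ψ : E → ℝ} {L C : ℝ≥0} (hd : LipschitzWith L d)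
    (hψ : LipschitzWith C ψ) (hc : HasCompactSupport ψ) {φ : ℕ → ContDiffBump (0 : E)}
    (hφ : Filter.Tendsto (fun k => (φ k).rOut) Filter.atTop (nhds 0))
    (hφ' : ∀ k, (φ k).rOut ≤ 2 * (φ k).rIn) (hφ1 : ∀ k, (φ k).rOut ≤ 1) (e : E) :
    Filter.Tendsto (fun k => ∫ x, lineDeriv ℝ d x e * lineDeriv ℝ (mollify (φ k) ψ) x e)
      Filter.atTop (nhds (∫ x, lineDeriv ℝ d x e * lineDeriv ℝ ψ x e)) := by
  set K := Metric.cthickening 1 (tsupport ψ)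
  have hK : IsCompact K := IsCompact.cthickening hc
  refine tendsto_integral_of_dominated_convergence
    (bound := K.indicator fun _ => (L * ‖e‖) * (C * ‖e‖)) (fun k => ?_) ?_ (fun k => ?_) ?_
  · exact ((measurable_lineDeriv hd.continuous).mul (measurable_lineDeriv
      (contDiff_mollify (φ k) hψ.continuous).continuous)).aestronglyMeasurable
  · exact (integrableOn_const hK.measure_lt_top.ne).integrable_indicator hK.measurableSet
  · refine Filter.Eventually.of_forall fun x => ?_
    by_cases hx : x ∈ K
    · rw [Set.indicator_of_mem hx, norm_mul]
      exact mul_le_mul (norm_lineDeriv_le_of_lipschitz ℝ hd) (norm_lineDeriv_mollify_le _ hψ _ _)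
        (norm_nonneg _) (by positivity)
    · rw [Set.indicator_of_notMem hx, lineDeriv_eq_zero_of_notMem_tsupport (f := mollify (φ k) ψ),
        mul_zero, norm_zero]
      exact fun h => hx (Metric.cthickening_mono (hφ1 k) _ (tsupport_mollify_subset _ h))
  · filter_upwards [ContDiffBump.ae_convolution_tendsto_right_of_locallyIntegrable (K := 2) hφ
      (Filter.Eventually.of_forall hφ') (hψ.locallyIntegrable_lineDeriv (μ := volume) e)] with x hx
    simp_rw [lineDeriv_mollify _ hψ]
    exact hx.const_mul _

lemma integral_inner_gradient_nonneg {d ψ : E → ℝ} {L C : ℝ≥0} {Ω : Set E} (hΩ : IsOpen Ω)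
    (hd : LipschitzWith L d)
    (hsup : ∀ φ : E → ℝ, IsTestFunction Ω φ → (∀ x, 0 ≤ φ x) → 0 ≤ ∫ x in Ω, d x * (-(Δ φ) x))
    (hψ : LipschitzWith C ψ) (hc : HasCompactSupport ψ) (hs : tsupport ψ ⊆ Ω)
    (h0 : ∀ x, 0 ≤ ψ x) :
    0 ≤ ∫ x, inner ℝ (∇ d x) (∇ ψ x) := by
  set b := stdOrthonormalBasis ℝ E
  rw [integral_inner_gradient hd hψ hc b]
  set φ : ℕ → ContDiffBump (0 : E) := fun k =>
    { rIn := 1 / 2 * (1 / ((k : ℝ) + 1))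
      rOut := 1 / ((k : ℝ) + 1)
      rIn_pos := by positivity
      rIn_lt_rOut := by
        have : 0 < 1 / ((k : ℝ) + 1) := by positivity
        linarith } with hφdef
  have hφ : Filter.Tendsto (fun k => (φ k).rOut) Filter.atTop (nhds 0) :=
    tendsto_one_div_add_atTop_nhds_zero_nat
  have hφ2 : ∀ k, (φ k).rOut ≤ 2 * (φ k).rIn := fun k => by simp only [hφdef]; linarith
  have hφ1 : ∀ k, (φ k).rOut ≤ 1 := fun k => by
    simp only [hφdef]
    rw [div_le_one (by positivity)]
    linarith [(Nat.cast_nonneg k : (0 : ℝ) ≤ k)]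
  -- Once the bump radius is at most `δ`, the mollified function is supported in `Ω` and is an
  -- admissible test function.
  obtain ⟨δ, hδ, hδΩ⟩ := IsCompact.exists_cthickening_subset_open hc hΩ hs
  refine ge_of_tendsto (tendsto_finsetSum _ fun i _ =>
    tendsto_integral_lineDeriv_mollify hd hψ hc hφ hφ2 hφ1 (b i)) ?_
  filter_upwards [hφ.eventually (ge_mem_nhds hδ)] with k hk
  have hsm := contDiff_mollify (φ k) hψ.continuous
  have hcs : HasCompactSupport (mollify (φ k) ψ) :=
    HasCompactSupport.convolution _ (φ k).hasCompactSupport_normed hc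
  have hsub : tsupport (mollify (φ k) ψ) ⊆ Ω :=
    (tsupport_mollify_subset _).trans ((Metric.cthickening_mono hk _).trans hδΩ)
  have h := hsup _ ⟨hsm, hcs, hsub⟩ (mollify_nonneg (φ k) h0)
  rwa [setIntegral_eq_integral_of_forall_compl_eq_zero, integral_mul_neg_laplacian hd hsm hcs b]
    at h
  intro x hx
  have h1 : mollify (φ k) ψ =ᶠ[nhds x] fun _ => 0 :=
    notMem_tsupport_iff_eventuallyEq.1 fun h => hx (hsub h)
  rw [(InnerProductSpace.laplacian_congr_nhds h1).eq_of_nhds]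
  simp [InnerProductSpace.laplacian_eq_iteratedFDeriv_stdOrthonormalBasis]

end Weak

/-! ### The inequality on a time slice -/

section Slice

open scoped NNReal

lemma lipschitzWith_mul_of_bounded {X : Type*} [PseudoMetricSpace X] {f g : X → ℝ} {Cf Cg : ℝ≥0}
    {Bf Bg : ℝ} (hf : LipschitzWith Cf f) (hg : LipschitzWith Cg g) (hBf : ∀ x, |f x| ≤ Bf)
    (hBg : ∀ x, |g x| ≤ Bg) : ∃ C, LipschitzWith C fun x => f x * g x := by
  refine ⟨(Bf * Cg + Bg * Cf).toNNReal, LipschitzWith.of_dist_le_mul fun x y => ?_⟩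
  have hBf0 := (abs_nonneg _).trans (hBf x)
  have hBg0 := (abs_nonneg _).trans (hBg x)
  rw [Real.coe_toNNReal _ (by positivity), Real.dist_eq]
  have h1 := hf.dist_le_mul x y
  have h2 := hg.dist_le_mul x y
  rw [Real.dist_eq] at h1 h2
  have e : f x * g x - f y * g y = f x * (g x - g y) + g y * (f x - f y) := by ring
  rw [e]
  refine (abs_add_le _ _).trans ?_
  rw [abs_mul, abs_mul]
  have := mul_le_mul (hBf x) h2 (abs_nonneg _) hBf0
  have := mul_le_mul (hBg y) h1 (abs_nonneg _) hBg0
  linarith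

/-- Lets weights such as `1/d²`, singular at the boundary, be treated as globally continuous after
multiplication by `u²`. -/
lemma continuous_sq_mul {X : Type*} [TopologicalSpace X] {u f : X → ℝ} {U : Set X}
    (hU : IsOpen U) (hu : Continuous u) (hs : tsupport u ⊆ U) (hf : ContinuousOn f U) :
    Continuous fun x => u x ^ 2 * f x := by
  refine ((hu.continuousOn.pow 2).mul hf).continuous_of_tsupport_subset hU ?_
  have : u ^ 2 * f = u * (u * f) := by ring
  rw [this]
  exact (tsupport_mul_subset_left).trans hs

lemma hasCompactSupport_sq_mul {X : Type*} [TopologicalSpace X] {u f : X → ℝ}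
    (hc : HasCompactSupport u) : HasCompactSupport fun x => u x ^ 2 * f x := by
  have : (fun x => u x ^ 2 * f x) = fun x => u x * (u x * f x) := by ext; ring
  rw [this]; exact hc.mul_right

/-- A Lipschitz function agreeing locally with a given `C¹` function on the image of a compact
set. -/
lemma exists_lipschitz_truncation {a a' : ℝ → ℝ} {δ M : ℝ} (hδM : δ ≤ M)
    (ha : ∀ r ∈ Set.Icc δ M, HasDerivAt a (a' r) r) (ha' : ContinuousOn a' (Set.Icc δ M)) :
    ∃ (b : ℝ → ℝ) (C : ℝ≥0) (B : ℝ), LipschitzWith C b ∧ (∀ r, |b r| ≤ B) ∧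
      (∀ r, ∃ s ∈ Set.Icc δ M, b r = a s) ∧ ∀ r ∈ Set.Ioo δ M, b =ᶠ[nhds r] a := by
  set c : ℝ → ℝ := fun r => max δ (min r M) with hc
  have hcL : LipschitzWith 1 c := (LipschitzWith.id.min_const M).const_max δ
  have hcm : ∀ r, c r ∈ Set.Icc δ M := fun r =>
    ⟨le_max_left _ _, max_le hδM (min_le_right _ _)⟩
  obtain ⟨D, hD⟩ := isCompact_Icc.exists_bound_of_continuousOn ha'
  have haL : LipschitzOnWith D.toNNReal a (Set.Icc δ M) := by
    refine (convex_Icc δ M).lipschitzOnWith_of_nnnorm_hasDerivWithin_le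
      (fun r hr => (ha r hr).hasDerivWithinAt) fun r hr => ?_
    rw [← NNReal.coe_le_coe, coe_nnnorm]
    exact (hD r hr).trans (Real.le_coe_toNNReal D)
  obtain ⟨B, hB⟩ := isCompact_Icc.exists_bound_of_continuousOn haL.continuousOn
  refine ⟨a ∘ c, _, B, lipschitzOnWith_univ.1
    (haL.comp hcL.lipschitzOnWith fun r _ => hcm r), fun r => hB _ (hcm r),
    fun r => ⟨c r, hcm r, rfl⟩, fun r hr => ?_⟩
  filter_upwards [Ioo_mem_nhds hr.1 hr.2] with s hs
  simp only [Function.comp_apply, hc, min_eq_left hs.2.le, max_eq_right hs.1.le]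

variable {E : Type*} [NormedAddCommGroup E] [InnerProductSpace ℝ E] [FiniteDimensional ℝ E]

lemma norm_gradient (f : E → ℝ) (x : E) : ‖∇ f x‖ = ‖fderiv ℝ f x‖ := by
  simp [gradient]

lemma norm_gradient_le_of_lipschitzWith {f : E → ℝ} {C : ℝ≥0} (hf : LipschitzWith C f) (x : E) :
    ‖∇ f x‖ ≤ C := by
  rw [norm_gradient]; exact norm_fderiv_le_of_lipschitz ℝ hf

lemma gradient_eq_zero_of_isLocalMin {f : E → ℝ} {x : E} (h : IsLocalMin f x) : ∇ f x = 0 := by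
  rw [gradient, h.fderiv_eq_zero, map_zero]

variable [MeasurableSpace E] [BorelSpace E]

/-- The properties of a distance function on `Ω` used in the proof: it is `1`-Lipschitz, positive
in `Ω`, has unit gradient almost everywhere in `Ω` and is weakly superharmonic in `Ω`. -/
structure SuperharmonicEikonal (Ω : Set E) (d : E → ℝ) : Prop where
  lipschitz : LipschitzWith 1 d
  pos : ∀ x ∈ Ω, 0 < d x
  norm_gradient_eq : ∀ᵐ x, x ∈ Ω → ‖∇ d x‖ = 1
  nonneg : ∀ (C : ℝ≥0) (ψ : E → ℝ), LipschitzWith C ψ → HasCompactSupport ψ → tsupport ψ ⊆ Ω →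
    (∀ x, 0 ≤ ψ x) → 0 ≤ ∫ x, inner ℝ (∇ d x) (∇ ψ x)

lemma measurable_gradient (f : E → ℝ) : Measurable (∇ f) :=
  (LinearIsometryEquiv.continuous _).measurable.comp (measurable_fderiv ℝ f)

lemma integrable_inner_gradient {d ψ : E → ℝ} {L C : ℝ≥0} (hd : LipschitzWith L d)
    (hψ : LipschitzWith C ψ) (hc : HasCompactSupport ψ) :
    Integrable fun x => (inner ℝ (∇ d x) (∇ ψ x) : ℝ) := by
  refine integrable_of_bounded_of_tsupport hc
    ((measurable_gradient d).inner (measurable_gradient ψ)).aestronglyMeasurable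
    (C := L * C) (fun x => ?_) fun x hx => ?_
  · exact (norm_inner_le_norm _ _).trans (mul_le_mul (norm_gradient_le_of_lipschitzWith hd x)
      (norm_gradient_le_of_lipschitzWith hψ x) (norm_nonneg _) (by positivity))
  · have h : ψ =ᶠ[nhds x] fun _ => 0 := notMem_tsupport_iff_eventuallyEq.1 hx
    have : ∇ ψ x = 0 := by rw [gradient, h.fderiv_eq]; simp
    rw [this, inner_zero_right]

/-- Integrates `|∇w - w·a(d)∇d|² ≥ 0`. With `|∇d| = 1`, the cross term equals `∇d·∇(w²a(d)) -
w²a'(d)`, and weak superharmonicity gives the first part a nonnegative integral because `a ≥ 0`. -/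
lemma slice_inequality {Ω : Set E} {d : E → ℝ} (hΩ : IsOpen Ω) (hd : SuperharmonicEikonal Ω d)
    {w : E → ℝ} (hw : ContDiff ℝ 1 w) (hc : HasCompactSupport w) (hs : tsupport w ⊆ Ω)
    {τ : ℝ} (hτ : 0 ≤ τ) :
    ∫ x, w x ^ 2 * (potX (τ / d x) / d x ^ 2) ≤ ∫ x, ‖∇ w x‖ ^ 2 := by
  have hdc := hd.lipschitz.continuous
  have hg := continuous_ric
  have hg1 := continuous_ric₁
  have hpX := continuous_potX
  obtain ⟨δ₀, hδ₀, hδ⟩ := IsCompact.exists_forall_le' hc hdc.continuousOn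
    (fun x hx => hd.pos x (hs hx))
  obtain ⟨M₀, hM⟩ := IsCompact.exists_bound_of_continuousOn hc hdc.continuousOn
  -- Halving the minimum and adding `1` to the maximum puts the values of `d` on the support
  -- strictly inside `(δ, M)`, where the truncation `b` agrees with `a` near each point.
  set δ := δ₀ / 2
  set M := max M₀ δ + 1
  have hδpos : 0 < δ := by positivity
  have hδM : δ ≤ M := by linarith [le_max_right M₀ δ]
  -- This is the logarithmic derivative in `r` of `prof (τ / r)`.
  set a : ℝ → ℝ := fun r => τ * ric (τ / r) / r ^ 2 with ha_def
  set a' : ℝ → ℝ := fun r => -(τ ^ 2 * ric₁ (τ / r) / r ^ 4 + 2 * τ * ric (τ / r) / r ^ 3)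
    with ha'_def
  have hpos : ∀ r ∈ Set.Icc δ M, 0 < r := fun r hr => hδpos.trans_le hr.1
  have ha : ∀ r ∈ Set.Icc δ M, HasDerivAt a (a' r) r := by
    intro r hr
    have hr0 := (hpos r hr).ne'
    have h1 : HasDerivAt (fun r => τ / r) (-τ / r ^ 2) r := by
      refine ((hasDerivAt_const r τ).div (hasDerivAt_id r) hr0).congr_deriv ?_
      simp
    have h2 := ((hasDerivAt_ric (τ / r)).comp r h1).const_mul τ
    refine (h2.div (hasDerivAt_pow 2 r) (pow_ne_zero 2 hr0)).congr_deriv ?_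
    simp only [ha'_def, Function.comp_apply]
    field_simp; push_cast; ring
  have ha'c : ContinuousOn a' (Set.Icc δ M) := by
    have h0 : ContinuousOn (fun r : ℝ => τ / r) (Set.Icc δ M) :=
      continuousOn_const.div continuousOn_id fun r hr => (hpos r hr).ne'
    refine ContinuousOn.neg (ContinuousOn.add ?_ ?_)
    · exact (continuousOn_const.mul (hg1.comp_continuousOn h0)).div (continuousOn_pow 4)
        fun r hr => pow_ne_zero 4 (hpos r hr).ne'
    · exact (continuousOn_const.mul (hg.comp_continuousOn h0)).div (continuousOn_pow 3)
        fun r hr => pow_ne_zero 3 (hpos r hr).ne'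
  obtain ⟨b, Cb, Bb, hbL, hbB, hba, hbeq⟩ := exists_lipschitz_truncation hδM ha ha'c
  have hb0 : ∀ r, 0 ≤ b r := by
    intro r
    obtain ⟨s, hs, e⟩ := hba r
    have := hpos s hs
    have := ric_nonneg (div_nonneg hτ this.le)
    rw [e]; simp only [ha_def]; positivity
  set ψ : E → ℝ := fun x => w x ^ 2 * b (d x) with hψ_def
  have hψ0 : ∀ x, 0 ≤ ψ x := fun x => mul_nonneg (sq_nonneg _) (hb0 _)
  have hw2c : HasCompactSupport fun x => w x ^ 2 := by
    simpa using hasCompactSupport_sq_mul (f := fun _ => 1) hc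
  obtain ⟨Cw, hCw⟩ := (hw.pow 2).lipschitzWith_of_hasCompactSupport hw2c one_ne_zero
  obtain ⟨Bw, hBw⟩ := hw2c.exists_bound_of_continuous (hw.continuous.pow 2)
  obtain ⟨C, hC⟩ := lipschitzWith_mul_of_bounded hCw (hbL.comp hd.lipschitz) hBw
    (fun x => hbB (d x))
  have hψL : LipschitzWith C ψ := hC
  have hψc : HasCompactSupport ψ := hasCompactSupport_sq_mul hc
  have hψs : tsupport ψ ⊆ Ω := by
    refine (closure_mono fun x hx => ?_).trans hs
    intro h0
    exact hx (by simp [hψ_def, h0])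
  have hnn := hd.nonneg C ψ hψL hψc hψs hψ0
  have hcont : ContinuousOn (fun x => potX (τ / d x) / d x ^ 2) Ω := by
    refine ContinuousOn.div (hpX.comp_continuousOn (continuousOn_const.div hdc.continuousOn
      fun x hx => (hd.pos x hx).ne')) (hdc.continuousOn.pow 2)
      fun x hx => pow_ne_zero 2 (hd.pos x hx).ne'
  have hi1 : Integrable fun x => w x ^ 2 * (potX (τ / d x) / d x ^ 2) :=
    (continuous_sq_mul hΩ hw.continuous hs hcont).integrable_of_hasCompactSupport
      (hasCompactSupport_sq_mul hc)
  have hi2 : Integrable fun x => ‖∇ w x‖ ^ 2 := by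
    simp_rw [norm_gradient]
    refine ((hw.continuous_fderiv one_ne_zero).norm.pow 2).integrable_of_hasCompactSupport ?_
    simp_rw [sq]
    exact (hc.fderiv ℝ).norm.mul_right
  have hi3 := integrable_inner_gradient hd.lipschitz hψL hψc
  have hmono : ∫ x, (w x ^ 2 * (potX (τ / d x) / d x ^ 2) + inner ℝ (∇ d x) (∇ ψ x))
      ≤ ∫ x, ‖∇ w x‖ ^ 2 := by
    refine integral_mono_ae (hi1.add hi3) hi2 ?_
    filter_upwards [hd.norm_gradient_eq, hd.lipschitz.ae_differentiableAt (μ := volume)]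
      with x hx hdx
    -- At a zero of `w` the nonnegative `ψ` attains its minimum, so its gradient vanishes, with no
    -- information on `d` at `x`.
    by_cases hwx : w x = 0
    · have : ∇ ψ x = 0 := gradient_eq_zero_of_isLocalMin
        (Filter.Eventually.of_forall fun y => by
          have : ψ x = 0 := by simp [hψ_def, hwx]
          rw [this]; exact hψ0 y)
      simp only [this, inner_zero_right, hwx]
      norm_num
    · have hxs : x ∈ tsupport w := subset_tsupport _ hwx
      have hxΩ := hs hxs
      have hdpos := hd.pos x hxΩ
      have hIoo : d x ∈ Set.Ioo δ M := by
        constructor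
        · have := hδ x hxs
          simp only [δ]; linarith
        · have := (le_abs_self (d x)).trans (hM x hxs)
          have := le_max_left M₀ δ
          simp only [M]; linarith
      have hbd : HasDerivAt b (a' (d x)) (d x) :=
        (ha _ (Set.Ioo_subset_Icc_self hIoo)).congr_of_eventuallyEq (hbeq _ hIoo)
      have hbx : b (d x) = a (d x) := (hbeq _ hIoo).eq_of_nhds
      have hwd := (hw.differentiable one_ne_zero x).hasFDerivAt
      have hfd := (hwd.pow 2).mul (hbd.comp_hasFDerivAt x hdx.hasFDerivAt)
      have hgrad : inner ℝ (∇ d x) (∇ ψ x)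
          = 2 * w x * a (d x) * inner ℝ (∇ d x) (∇ w x) + w x ^ 2 * a' (d x) := by
        have e1 : fderiv ℝ d x (∇ d x) = 1 := by
          rw [← inner_gradient_left, real_inner_self_eq_norm_sq, hx hxΩ, one_pow]
        rw [real_inner_comm, inner_gradient_left, real_inner_comm, inner_gradient_left,
          show fderiv ℝ ψ x = _ from hfd.fderiv]
        simp only [Function.comp_apply, add_apply, smul_apply, smul_eq_mul, e1, hbx]
        push_cast
        ring
      have hn : ‖∇ w x - (w x * a (d x)) • ∇ d x‖ ^ 2
          = ‖∇ w x‖ ^ 2 - 2 * w x * a (d x) * inner ℝ (∇ d x) (∇ w x)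
            + w x ^ 2 * a (d x) ^ 2 := by
        rw [norm_sub_sq_real, inner_smul_right, norm_smul, hx hxΩ, real_inner_comm, mul_one,
          Real.norm_eq_abs, sq_abs]
        ring
      have hp : potX (τ / d x) / d x ^ 2 = -(a' (d x) + a (d x) ^ 2) := by
        simp only [ha'_def, ha_def, potX, potT]
        field_simp; ring
      have := sq_nonneg ‖∇ w x - (w x * a (d x)) • ∇ d x‖
      simp only [hgrad, hp]
      linarith
  rw [integral_add hi1 hi3] at hmono
  linarith

end Slice

/-! ### The trace Hardy inequality -/

section Main

open scoped NNReal

/-- On the segment from `x` to a nearest point of `S`, the distance decreases at unit speed, so the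
gradient has norm at least `1`; the Lipschitz constant gives the other bound. -/
lemma norm_gradient_infDist {E : Type*} [NormedAddCommGroup E] [InnerProductSpace ℝ E]
    [FiniteDimensional ℝ E] {S : Set E} (hS : IsClosed S) (hne : S.Nonempty) {x : E}
    (hx : x ∉ S) (hdiff : DifferentiableAt ℝ (fun y => Metric.infDist y S) x) :
    ‖∇ (fun y => Metric.infDist y S) x‖ = 1 := by
  have hL : LipschitzWith 1 fun y => Metric.infDist y S := Metric.lipschitz_infDist_pt S
  refine le_antisymm (by simpa using norm_gradient_le_of_lipschitzWith hL x) ?_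
  obtain ⟨y, hy, hxy⟩ := hS.exists_infDist_eq_dist hne x
  have hpos : 0 < dist x y := dist_pos.2 fun h => hx (h ▸ hy)
  have hray : ∀ s ∈ Set.Icc (0 : ℝ) 1,
      Metric.infDist (x + s • (y - x)) S = dist x y - s * dist x y := by
    intro s hs
    have e1 : dist x (x + s • (y - x)) = s * dist x y := by
      rw [dist_self_add_right, norm_smul, Real.norm_of_nonneg hs.1, dist_comm x y, dist_eq_norm]
    have e2 : dist (x + s • (y - x)) y = (1 - s) * dist x y := by
      rw [dist_eq_norm, show x + s • (y - x) - y = (1 - s) • (x - y) by module, norm_smul,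
        Real.norm_of_nonneg (sub_nonneg.2 hs.2), dist_eq_norm]
    have h1 := Metric.infDist_le_dist_of_mem (x := x + s • (y - x)) hy
    have h2 := Metric.infDist_le_infDist_add_dist (s := S) (x := x) (y := x + s • (y - x))
    rw [e2] at h1
    rw [e1, hxy] at h2
    linarith
  have hline : HasDerivAt (fun s : ℝ => Metric.infDist (x + s • (y - x)) S)
      (fderiv ℝ (fun y => Metric.infDist y S) x (y - x)) 0 :=
    hdiff.hasFDerivAt.hasLineDerivAt (y - x)
  have hlin : HasDerivAt (fun s : ℝ => dist x y - s * dist x y) (-dist x y) 0 := by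
    simpa using ((hasDerivAt_id (0 : ℝ)).mul_const (dist x y)).const_sub (dist x y)
  have heq : fderiv ℝ (fun y => Metric.infDist y S) x (y - x) = -dist x y := by
    -- The formula along the segment is known only for `0 ≤ s ≤ 1`, so derivatives at `0` are
    -- compared within that interval.
    have hu : UniqueDiffWithinAt ℝ (Set.Icc (0 : ℝ) 1) 0 :=
      uniqueDiffOn_Icc one_pos 0 (Set.left_mem_Icc.2 zero_le_one)
    exact hu.eq_deriv _ hline.hasDerivWithinAt
      (hlin.hasDerivWithinAt.congr hray (hray 0 (Set.left_mem_Icc.2 zero_le_one)))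
  have hle := (fderiv ℝ (fun y => Metric.infDist y S) x).le_opNorm (y - x)
  rw [heq, norm_neg, Real.norm_of_nonneg dist_nonneg, ← dist_eq_norm, dist_comm y x] at hle
  rw [norm_gradient]
  exact le_of_mul_le_mul_right (by rwa [one_mul]) hpos

variable {E : Type*} [NormedAddCommGroup E] [InnerProductSpace ℝ E] [FiniteDimensional ℝ E]
  [MeasurableSpace E] [BorelSpace E]

theorem trace_hardy {Ω : Set E} {d : E → ℝ} (hΩ : IsOpen Ω) (hd : SuperharmonicEikonal Ω d)
    {u : E × ℝ → ℝ} (hu : IsTestFunction (Ω ×ˢ (Set.univ : Set ℝ)) u) :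
    (1 / 4 : ℝ) * (∫ t : ℝ, ∫ x in Ω, u (x, t) ^ 2 / d x ^ 2)
      + 4 * (Real.Gamma (3 / 4) / Real.Gamma (1 / 4)) ^ 2 * (∫ x in Ω, u (x, 0) ^ 2 / d x)
      ≤ ∫ t : ℝ, ∫ x in Ω, (‖∇ (fun y => u (y, t)) x‖ ^ 2
          + (deriv (fun τ => u (x, τ)) t) ^ 2) := by
  obtain ⟨hsm, hc, hs⟩ := hu
  have hu1 : ContDiff ℝ 1 u := hsm.of_le (by simp)
  have hdiff : Differentiable ℝ u := hu1.differentiable one_ne_zero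
  have hfc : Continuous (fderiv ℝ u) := hu1.continuous_fderiv one_ne_zero
  have hUo : IsOpen (Ω ×ˢ (Set.univ : Set ℝ)) := hΩ.prod isOpen_univ
  have hdc := hd.lipschitz.continuous
  have hpX := continuous_potX
  have hpT := continuous_potT
  -- slices
  have hxsm : ∀ t, ContDiff ℝ 1 fun y => u (y, t) := fun t =>
    hu1.comp (contDiff_id.prodMk contDiff_const)
  have htsm : ∀ x, ContDiff ℝ 1 fun τ => u (x, τ) := fun x =>
    hu1.comp (contDiff_const.prodMk contDiff_id)
  have hxc : ∀ t, HasCompactSupport fun y => u (y, t) := fun t =>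
    HasCompactSupport.intro
    (hc.isCompact.image continuous_fst) fun x hx =>
      image_eq_zero_of_notMem_tsupport fun h => hx ⟨(x, t), h, rfl⟩
  have htc : ∀ x, HasCompactSupport fun τ => u (x, τ) := fun x =>
    HasCompactSupport.intro
    (hc.isCompact.image continuous_snd) fun t ht =>
      image_eq_zero_of_notMem_tsupport fun h => ht ⟨(x, t), h, rfl⟩
  have hxs : ∀ t, tsupport (fun y => u (y, t)) ⊆ Ω := fun t x hx =>
    (hs (tsupport_comp_subset_preimage u (f := fun y => (y, t)) (by fun_prop) hx)).1
  have hgradX : ∀ x t, ‖∇ (fun y => u (y, t)) x‖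
      = ‖(fderiv ℝ u (x, t)).comp (ContinuousLinearMap.inl ℝ E ℝ)‖ := by
    intro x t
    rw [norm_gradient]
    have h := HasFDerivAt.comp (f := fun y : E => (y, t)) x (hdiff (x, t)).hasFDerivAt
      (hasFDerivAt_prodMk_left x t)
    rw [show fderiv ℝ (fun y => u (y, t)) x = _ from h.fderiv]
  have hderivT : ∀ x t, deriv (fun τ => u (x, τ)) t = fderiv ℝ u (x, t) (0, 1) := by
    intro x t
    have h := HasFDerivAt.comp (f := fun τ : ℝ => (x, τ)) t (hdiff (x, t)).hasFDerivAt
      (hasFDerivAt_prodMk_right x t)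
    rw [show deriv (fun τ => u (x, τ)) t = _ from h.hasDerivAt.deriv]
    simp
  set U₁ : E × ℝ → ℝ := fun p => ‖∇ (fun y => u (y, p.2)) p.1‖ ^ 2 with hU₁
  set U₂ : E × ℝ → ℝ := fun p => (deriv (fun τ => u (p.1, τ)) p.2) ^ 2 with hU₂
  set V₁ : E × ℝ → ℝ := fun p => u p ^ 2 * (potX (|p.2| / d p.1) / d p.1 ^ 2) with hV₁
  set V₂ : E × ℝ → ℝ := fun p => u p ^ 2 * (potT (|p.2| / d p.1) / d p.1 ^ 2) with hV₂
  have iU₁ : Integrable U₁ (volume.prod volume) := by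
    have e : U₁ = (fun A : E × ℝ →L[ℝ] ℝ => ‖A.comp (ContinuousLinearMap.inl ℝ E ℝ)‖ ^ 2)
        ∘ fderiv ℝ u := by ext p; simp only [hU₁, hgradX]; rfl
    rw [e]
    refine Continuous.integrable_of_hasCompactSupport ?_ ((hc.fderiv ℝ).comp_left (by simp))
    exact Continuous.comp (by fun_prop) hfc
  have iU₂ : Integrable U₂ (volume.prod volume) := by
    have e : U₂ = (fun A : E × ℝ →L[ℝ] ℝ => (A (0, 1)) ^ 2) ∘ fderiv ℝ u := by
      ext p; simp only [hU₂, hderivT]; rfl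
    rw [e]
    refine Continuous.integrable_of_hasCompactSupport ?_ ((hc.fderiv ℝ).comp_left (by simp))
    exact Continuous.comp (by fun_prop) hfc
  have hdne : ∀ p ∈ Ω ×ˢ (Set.univ : Set ℝ), d p.1 ≠ 0 := fun p hp => (hd.pos _ hp.1).ne'
  have hd1 : ContinuousOn (fun p : E × ℝ => d p.1) (Ω ×ˢ Set.univ) := by fun_prop
  have hquot : ContinuousOn (fun p : E × ℝ => |p.2| / d p.1) (Ω ×ˢ Set.univ) :=
    ContinuousOn.div (by fun_prop) hd1 hdne
  have hpot : ∀ f : ℝ → ℝ, Continuous f → Integrable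
      (fun p : E × ℝ => u p ^ 2 * (f (|p.2| / d p.1) / d p.1 ^ 2)) (volume.prod volume) := by
    intro f hf
    refine Continuous.integrable_of_hasCompactSupport ?_ (hasCompactSupport_sq_mul hc)
    exact continuous_sq_mul hUo hu1.continuous hs ((hf.comp_continuousOn hquot).div (hd1.pow 2)
      fun p hp => pow_ne_zero 2 (hdne p hp))
  have iV₁ : Integrable V₁ (volume.prod volume) := hpot _ hpX
  have iV₂ : Integrable V₂ (volume.prod volume) := hpot _ hpT
  have iT : Integrable fun x : E => u (x, 0) ^ 2 * (1 / d x) := by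
    refine Continuous.integrable_of_hasCompactSupport ?_ (hasCompactSupport_sq_mul (hxc 0))
    exact continuous_sq_mul hΩ (hxsm 0).continuous (hxs 0)
      (continuousOn_const.div hdc.continuousOn fun x hx => (hd.pos x hx).ne')
  -- Slices at fixed `t`, with `τ = |t|`.
  have step₁ : ∫ p, V₁ p ∂(volume.prod volume) ≤ ∫ p, U₁ p ∂(volume.prod volume) := by
    rw [integral_prod_symm _ iV₁, integral_prod_symm _ iU₁]
    exact integral_mono iV₁.integral_prod_right iU₁.integral_prod_right fun t =>
      slice_inequality hΩ hd (hxsm t) (hxc t) (hxs t) (abs_nonneg t)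
  have hzero : ∀ x ∉ Ω, ∀ t, u (x, t) = 0 := fun x hx t =>
    image_eq_zero_of_notMem_tsupport fun h => hx (hs h).1
  have step₂ : ∫ p, V₂ p ∂(volume.prod volume) + 2 * ric 0 * ∫ x, u (x, 0) ^ 2 * (1 / d x)
      ≤ ∫ p, U₂ p ∂(volume.prod volume) := by
    rw [integral_prod _ iV₂, integral_prod _ iU₂, ← integral_const_mul,
      ← integral_add iV₂.integral_prod_left (iT.const_mul _)]
    refine integral_mono (iV₂.integral_prod_left.add (iT.const_mul _)) iU₂.integral_prod_left
      fun x => ?_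
    -- Outside `Ω` the slice vanishes identically, and only a nonnegative right side remains.
    by_cases hx : x ∈ Ω
    · have := line_inequality (htsm x) (htc x) (hd.pos x hx)
      refine le_trans (le_of_eq ?_) this
      simp only [hV₂]
      ring
    · simp only [hV₂, hzero x hx]
      norm_num
      exact integral_nonneg fun t => sq_nonneg _
  -- The factor `4` undoes `potX + potT = 1/4`.
  have eV : ∫ t : ℝ, ∫ x in Ω, u (x, t) ^ 2 / d x ^ 2
      = 4 * (∫ p, V₁ p ∂(volume.prod volume) + ∫ p, V₂ p ∂(volume.prod volume)) := by
    rw [← integral_add iV₁ iV₂, ← integral_const_mul,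
      integral_prod_symm _ (by exact (iV₁.add iV₂).const_mul 4)]
    refine integral_congr_ae (Filter.Eventually.of_forall fun t => ?_)
    simp only
    rw [setIntegral_eq_integral_of_forall_compl_eq_zero fun x hx => by simp [hzero x hx]]
    refine integral_congr_ae (Filter.Eventually.of_forall fun x => ?_)
    simp only [hV₁, hV₂, ← mul_add, ← add_div, potX_add_potT]
    ring
  have eU : ∫ t : ℝ, ∫ x in Ω, (‖∇ (fun y => u (y, t)) x‖ ^ 2
          + (deriv (fun τ => u (x, τ)) t) ^ 2)
      = ∫ p, U₁ p ∂(volume.prod volume) + ∫ p, U₂ p ∂(volume.prod volume) := by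
    rw [← integral_add iU₁ iU₂, integral_prod_symm _ (by exact iU₁.add iU₂)]
    refine integral_congr_ae (Filter.Eventually.of_forall fun t => ?_)
    simp only
    rw [setIntegral_eq_integral_of_forall_compl_eq_zero fun x hx => ?_]
    have h0 : fderiv ℝ u (x, t) = 0 := by
      have h : u =ᶠ[nhds (x, t)] fun _ => 0 :=
        notMem_tsupport_iff_eventuallyEq.1 fun h => hx (hs h).1
      rw [h.fderiv_eq]; simp
    rw [hgradX, hderivT, h0]; simp
  have eT : ∫ x in Ω, u (x, 0) ^ 2 / d x = ∫ x, u (x, 0) ^ 2 * (1 / d x) := by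
    rw [setIntegral_eq_integral_of_forall_compl_eq_zero fun x hx => by simp [hzero x hx]]
    simp_rw [mul_one_div]
  rw [eV, eU, eT]
  rw [ric_zero] at step₂
  linarith

lemma superharmonicEikonal_bdryDist {n : ℕ} {Ω : Set (EuclideanSpace ℝ (Fin n))}
    (hΩ : IsOpen Ω) (hne : Ω.Nonempty) (huniv : Ω ≠ Set.univ)
    (hsup : NegLaplacianDistNonneg Ω) : SuperharmonicEikonal Ω (bdryDist Ω) := by
  have hL : LipschitzWith 1 (bdryDist Ω) := Metric.lipschitz_infDist_pt _
  have hfr : (frontier Ω).Nonempty := nonempty_frontier_iff.2 ⟨hne, huniv⟩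
  have hnot : ∀ x ∈ Ω, x ∉ frontier Ω := fun x hx h => by
    rw [hΩ.frontier_eq] at h; exact h.2 hx
  refine ⟨hL, fun x hx => (isClosed_frontier.notMem_iff_infDist_pos hfr).1 (hnot x hx), ?_,
    fun C ψ hψ hc hs h0 => integral_inner_gradient_nonneg hΩ hL hsup hψ hc hs h0⟩
  filter_upwards [hL.ae_differentiableAt (μ := volume)] with x hdx hx
  exact norm_gradient_infDist isClosed_frontier hfr (hnot x hx) hdx

/-- A linear function is harmonic: `∫ ∇d·∇ψ` is the integral of a directional derivative of a
compactly supported function, hence zero. -/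
lemma superharmonicEikonal_inner {v : E} (hv : ‖v‖ = 1) {Ω : Set E}
    (hpos : ∀ x ∈ Ω, 0 < (inner ℝ v x : ℝ)) :
    SuperharmonicEikonal Ω fun x => inner ℝ v x := by
  have hgrad : ∀ x, ∇ (fun x => (inner ℝ v x : ℝ)) x = v := fun x => by
    have h : HasFDerivAt (fun x => (inner ℝ v x : ℝ)) (innerSL ℝ v) x :=
      (innerSL ℝ v).hasFDerivAt
    refine HasGradientAt.gradient (hasGradientAt_iff_hasFDerivAt.2 ?_)
    convert! h using 1
  refine ⟨?_, hpos, Filter.Eventually.of_forall fun x _ => by rw [hgrad, hv],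
    fun C ψ hψ hc _ _ => ?_⟩
  · refine LipschitzWith.of_dist_le_mul fun x y => ?_
    rw [Real.dist_eq, ← inner_sub_right, dist_eq_norm]
    simpa [hv] using abs_real_inner_le_norm v (x - y)
  -- Integration by parts against the constant `1`.
  · have h := LipschitzWith.integral_lineDeriv_mul_eq (μ := volume)
      (LipschitzWith.const (1 : ℝ) : LipschitzWith 0 fun _ : E => (1 : ℝ)) hψ hc (-v)
    have e : ∀ x : E, lineDeriv ℝ (fun _ : E => (1 : ℝ)) x (-v) = 0 := fun x => by simp [lineDeriv]
    simp_rw [e, zero_mul, neg_neg, mul_one, integral_zero] at h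
    rw [h]
    refine le_of_eq (integral_congr_ae ?_)
    filter_upwards [hψ.ae_differentiableAt (μ := volume)] with x hx
    rw [hgrad, real_inner_comm, inner_gradient_left, hx.lineDeriv_eq_fderiv]

end Main

end TraceHardy

end

theorem mainTheorem7 (n : ℕ) (hn : 2 ≤ n) :
    (∀ u : EuclideanSpace ℝ (Fin n) × ℝ → ℝ,
      TraceHardy.IsTestFunction (TraceHardy.halfSpace n hn ×ˢ (Set.univ : Set ℝ)) u →
        (1 / 4 : ℝ) * (∫ t : ℝ, ∫ x in TraceHardy.halfSpace n hn,
            u (x, t) ^ 2 / (x (TraceHardy.lastIdx n hn)) ^ 2)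
          + 4 * (Real.Gamma (3 / 4) / Real.Gamma (1 / 4)) ^ 2 *
            (∫ x in TraceHardy.halfSpace n hn, u (x, 0) ^ 2 / x (TraceHardy.lastIdx n hn))
          ≤ ∫ t : ℝ, ∫ x in TraceHardy.halfSpace n hn, TraceHardy.gradSq u x t) ∧
    (∀ Ω : Set (EuclideanSpace ℝ (Fin n)), IsOpen Ω → IsConnected Ω → Ω ≠ Set.univ →
      TraceHardy.NegLaplacianDistNonneg Ω →
      ∀ u : EuclideanSpace ℝ (Fin n) × ℝ → ℝ,
        TraceHardy.IsTestFunction (Ω ×ˢ (Set.univ : Set ℝ)) u →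
        (1 / 4 : ℝ) * (∫ t : ℝ, ∫ x in Ω, u (x, t) ^ 2 / (TraceHardy.bdryDist Ω x) ^ 2)
          + 4 * (Real.Gamma (3 / 4) / Real.Gamma (1 / 4)) ^ 2 *
            (∫ x in Ω, u (x, 0) ^ 2 / TraceHardy.bdryDist Ω x)
          ≤ ∫ t : ℝ, ∫ x in Ω, TraceHardy.gradSq u x t) := by
  refine ⟨fun u hu => ?_, fun Ω hΩ hconn huniv hsup u hu =>
    TraceHardy.trace_hardy hΩ
      (TraceHardy.superharmonicEikonal_bdryDist hΩ hconn.nonempty huniv hsup) hu⟩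
  set i := TraceHardy.lastIdx n hn with hi
  -- Taking `d = x_n` as an inner product with a unit vector avoids identifying the half-space's
  -- distance function.
  have hcoord : (fun x : EuclideanSpace ℝ (Fin n) =>
      (inner ℝ (EuclideanSpace.single i (1 : ℝ)) x : ℝ)) = fun x => x i := by
    ext x; simp [EuclideanSpace.inner_single_left]
  have hopen : IsOpen (TraceHardy.halfSpace n hn) :=
    isOpen_lt continuous_const (EuclideanSpace.proj (𝕜 := ℝ) i).continuous
  have hd := TraceHardy.superharmonicEikonal_inner (v := EuclideanSpace.single i (1 : ℝ))
    (by simp) (Ω := TraceHardy.halfSpace n hn) fun x hx => by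
      rw [congrFun hcoord x]; exact hx
  rw [hcoord] at hd
  exact TraceHardy.trace_hardy hopen hd hu
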